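/- Let $m \ge 0$ be a fixed integer and let $d \in (1/2,1)$. For each natural number $n$ let $E_n$ be a natural number obtained by rounding $n^{(2m+1)d}$, that is, $|E_n - n^{(2m+1)d}| < 1$ (for instance $E_n = \lfloor n^{(2m+1)d} \rfloor$ for every $n$). Let $\Gamma_n$ be sampled uniformly at random from the set of all bipartite graphs with fixed (labelled) parts $V_1$ and $V_2$, where $|V_1| = n^m$ and $|V_2| = n^{m+1}$, having exactly $E_n$ edges, each joining a vertex of $V_1$ to a vertex of $V_2$. Then asymptotically almost surely all vertices of $V_1$ lie in the same connected component of $\Gamma_n$; that is, $$\lim_{n\to\infty} \mathbb{P}\bigl(\text{all vertices of } V_1 \text{ lie in the same connected component of } \Gamma_n\bigr) = 1.$$ -/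

import Mathlib

/-- The bipartite graphs with (labelled) parts `V₁ = Fin a` and `V₂ = Fin b` and exactly `e` edges,
as simple graphs on the disjoint union of the two parts. -/
def bipartiteGraphs (a b e : ℕ) : Set (SimpleGraph (Fin a ⊕ Fin b)) :=
  {G | G.IsBipartiteWith (Set.range Sum.inl) (Set.range Sum.inr) ∧ G.edgeSet.ncard = e}

/-- The law of the random bipartite graph `Γ(a, b, e)`: the uniform distribution on
`bipartiteGraphs a b e`, every set of graphs being measurable (discrete σ-algebra). -/
noncomputable def randomBipartiteGraph (a b e : ℕ) :
    @MeasureTheory.Measure (SimpleGraph (Fin a ⊕ Fin b)) ⊤ :=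
  @ProbabilityTheory.uniformOn (SimpleGraph (Fin a ⊕ Fin b)) ⊤ (bipartiteGraphs a b e)

/-- The event that all vertices of the first part lie in the same connected component. -/
def firstPartConnected (a b : ℕ) : Set (SimpleGraph (Fin a ⊕ Fin b)) :=
  {G | ∀ u v : Fin a, G.connectedComponentMk (Sum.inl u) = G.connectedComponentMk (Sum.inl v)}

/-!
If the first part, of size `a`, is not contained in one component, then some nonempty set `S` of at
most `a / 2` of its vertices is *separated*: no vertex of the second part, of size `b`, has
neighbours both in `S` and in the rest of the first part. It suffices to bound the expected number
of such `S`.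

Put `p = e / (a * b)` and compare the uniform model with `e` edges to the model in which every pair
is an edge independently with probability `p`. Given its number of edges the latter is uniform, and
it has exactly `e` edges with probability at least `1 / (a * b + 1)`, since `e` is the mode of the
number of edges (`one_le_succ_mul_choose_mul_pow`). So the comparison costs a factor `a * b + 1`
only. In the independent model the neighbourhoods of the `b` vertices of the second part are
independent, and a set `S` of size `s` is separated with probability
`(1 - (1 - q ^ s) * (1 - q ^ (a - s))) ^ b`, where `q = 1 - p` (`sum_isSeparatedBy_le`). For
`s ≤ a / 2` this is at most `exp (-s * L)` with `L = min (e ^ 2 / (a * b)) (b / a) / 8`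
(`mul_min_le_mul_one_sub_pow`). Summing over `S` gives `(1 + exp (-L)) ^ a - 1`, hence the bound
`(a * b + 1) * (exp (a * exp (-L)) - 1)` on the probability of failure
(`one_sub_le_randomBipartiteGraph`).

For `a = n ^ m`, `b = n ^ (m + 1)` and `e` about `n ^ ((2 * m + 1) * d)`, the two terms of the
minimum are of order `n ^ ((2 * m + 1) * (2 * d - 1))` and `n`. As `d > 1 / 2`, `L` grows like a
positive power of `n`, and `exp (-L)` beats the polynomial factors.
-/

/-! ### The mode of a binomial distribution -/

/-- The ratio of consecutive binomial coefficients, iterated `i` times from `e`. -/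
theorem choose_add_mul_pow_le (N e i : ℕ) :
    N.choose (e + i) * e ^ i ≤ N.choose e * (N - e) ^ i := by
  induction i with
  | zero => simp
  | succ i ih =>
    have h := Nat.choose_succ_right_eq N (e + i)
    calc N.choose (e + (i + 1)) * e ^ (i + 1)
        = (N.choose (e + i + 1) * e) * e ^ i := by rw [← add_assoc]; ring
      _ ≤ (N.choose (e + i + 1) * (e + i + 1)) * e ^ i := by gcongr; omega
      _ = (N.choose (e + i) * e ^ i) * (N - (e + i)) := by rw [h]; ring
      _ ≤ (N.choose e * (N - e) ^ i) * (N - e) := by gcongr; omega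
      _ = N.choose e * (N - e) ^ (i + 1) := by ring

theorem choose_mul_pow_mul_pow_le_of_le {N e k : ℕ} (hek : e ≤ k) (hk : k ≤ N) :
    N.choose k * e ^ k * (N - e) ^ (N - k) ≤ N.choose e * e ^ e * (N - e) ^ (N - e) := by
  obtain ⟨i, rfl⟩ := Nat.exists_eq_add_of_le hek
  have h1 : N - e = i + (N - (e + i)) := by omega
  calc N.choose (e + i) * e ^ (e + i) * (N - e) ^ (N - (e + i))
      = (N.choose (e + i) * e ^ i) * (e ^ e * (N - e) ^ (N - (e + i))) := by ring
    _ ≤ (N.choose e * (N - e) ^ i) * (e ^ e * (N - e) ^ (N - (e + i))) := by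
        exact Nat.mul_le_mul_right _ (choose_add_mul_pow_le N e i)
    _ = N.choose e * e ^ e * (N - e) ^ (i + (N - (e + i))) := by ring
    _ = _ := by rw [← h1]

/-- The mode of the binomial distribution with `N` trials and success probability `e / N` is `e`,
with denominators cleared. -/
theorem choose_mul_pow_mul_pow_le {N e k : ℕ} (he : e ≤ N) (hk : k ≤ N) :
    N.choose k * e ^ k * (N - e) ^ (N - k) ≤ N.choose e * e ^ e * (N - e) ^ (N - e) := by
  -- Below the mode, exchange successes and failures.
  rcases le_total e k with h | h
  · exact choose_mul_pow_mul_pow_le_of_le h hk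
  · have := choose_mul_pow_mul_pow_le_of_le (N := N) (e := N - e) (k := N - k)
      (by omega) (by omega)
    rw [Nat.choose_symm hk, Nat.choose_symm he, Nat.sub_sub_self he, Nat.sub_sub_self hk] at this
    linarith [this]

/-- A binomial variable with `N` trials and mean `e` takes the value `e` with probability at least
`1 / (N + 1)`: it has `N + 1` possible values, and `e` is the most likely one. This lets the
uniform model with `e` edges be compared with the model of independent edges at a polynomial
cost. -/
theorem one_le_succ_mul_choose_mul_pow {N e : ℕ} (hN : 0 < N) (he : e ≤ N) :
    (1 : ℝ) ≤ (N + 1) * (N.choose e * ((e / N : ℝ) ^ e * (1 - e / N : ℝ) ^ (N - e))) := by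
  have hN' : (0 : ℝ) < N := by exact_mod_cast hN
  have key : N ^ N ≤ (N + 1) * (N.choose e * e ^ e * (N - e) ^ (N - e)) := by
    calc N ^ N = (e + (N - e)) ^ N := by rw [Nat.add_sub_cancel' he]
      _ = ∑ k ∈ Finset.range (N + 1), e ^ k * (N - e) ^ (N - k) * N.choose k := add_pow _ _ _
      _ ≤ ∑ k ∈ Finset.range (N + 1), N.choose e * e ^ e * (N - e) ^ (N - e) := by
          refine Finset.sum_le_sum fun k hk => ?_
          have := choose_mul_pow_mul_pow_le he (Nat.lt_succ_iff.mp (Finset.mem_range.mp hk))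
          linarith
      _ = _ := by simp
  have key' : (N : ℝ) ^ N ≤ (N + 1) * (N.choose e * e ^ e * (N - e) ^ (N - e)) := by
    rw [← Nat.cast_sub he]; exact_mod_cast key
  have h1 : (1 - e / N : ℝ) = (N - e) / N := by field_simp
  have h2 : (N : ℝ) ^ N = N ^ e * N ^ (N - e) := by rw [← pow_add, Nat.add_sub_cancel' he]
  rw [h1, div_pow, div_pow, div_mul_div_comm, ← h2, mul_div_assoc', mul_div_assoc',
    le_div_iff₀ (by positivity), one_mul]
  linarith

/-! ### Edge sets separated by a set of vertices -/

open Finset in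
/-- A random subset of `α` that contains each element independently with probability `p` lies
in `S` with probability `q ^ #Sᶜ`. -/
theorem sum_powerset_pow_mul_pow {α : Type*} [Fintype α] [DecidableEq α] (S : Finset α)
    {p q : ℝ} (hpq : p + q = 1) :
    ∑ B ∈ S.powerset, p ^ #B * q ^ (Fintype.card α - #B) = q ^ (Fintype.card α - #S) := by
  have h : ∀ B ∈ S.powerset, p ^ #B * q ^ (Fintype.card α - #B)
      = p ^ #B * q ^ (#S - #B) * q ^ (Fintype.card α - #S) := fun B hB => by
    have h1 := card_le_card (mem_powerset.mp hB)
    have h2 := card_le_univ S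
    rw [mul_assoc, ← pow_add]; congr 2; omega
  rw [sum_congr rfl h, ← sum_mul, sum_pow_mul_eq_add_pow, hpq, one_pow, one_mul]

open Finset in
/-- The probability that a random subset of `α` does not meet both `S` and its complement, by
inclusion-exclusion. -/
theorem sum_powerset_union_powerset_compl {α : Type*} [Fintype α] [DecidableEq α] (S : Finset α)
    {p q : ℝ} (hpq : p + q = 1) :
    ∑ B ∈ S.powerset ∪ Sᶜ.powerset, p ^ #B * q ^ (Fintype.card α - #B)
      = 1 - (1 - q ^ #S) * (1 - q ^ (Fintype.card α - #S)) := by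
  have h := sum_union_inter (s₁ := S.powerset) (s₂ := Sᶜ.powerset)
    (f := fun B => p ^ #B * q ^ (Fintype.card α - #B))
  have h0 : S.powerset ∩ Sᶜ.powerset = {∅} := by
    ext B
    simp only [mem_inter, mem_powerset, mem_singleton]
    refine ⟨fun ⟨h1, h2⟩ => ?_, fun h => by simp [h]⟩
    exact disjoint_self_iff_empty _ |>.mp (disjoint_of_subset_left h1
      (disjoint_of_subset_right h2 disjoint_compl_right))
  have h1 := card_le_univ S
  have h2 : Fintype.card α - #Sᶜ = #S := by rw [card_compl]; omega
  have h3 : q ^ Fintype.card α = q ^ #S * q ^ (Fintype.card α - #S) := by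
    rw [← pow_add]; congr 1; omega
  rw [h0, sum_powerset_pow_mul_pow S hpq, sum_powerset_pow_mul_pow Sᶜ hpq, h2] at h
  simp only [sum_singleton, card_empty, pow_zero, one_mul, Nat.sub_zero] at h
  linarith

/-- No element of `β` is joined by the edge set `A` both to an element of `S` and to an element
outside `S`; that is, `S` is the trace on `α` of a union of connected components. -/
def IsSeparatedBy {α β : Type*} (S : Finset α) (A : Finset (α × β)) : Prop :=
  ∀ i i' j, (i, j) ∈ A → (i', j) ∈ A → (i ∈ S ↔ i' ∈ S)

open Finset Classical in
/-- When every pair is present independently with probability `p`, the neighbourhoods of the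
elements of `β` are independent random subsets of `α`, and `S` separates the edges if and only if none
of them meets both `S` and its complement. -/
theorem sum_isSeparatedBy_le {α β : Type*} [Fintype α] [Fintype β]
    (S : Finset α) {p q : ℝ} (hp : 0 ≤ p) (hq : 0 ≤ q) (hpq : p + q = 1) :
    ∑ A : Finset (α × β) with IsSeparatedBy S A,
        p ^ #A * q ^ (Fintype.card α * Fintype.card β - #A)
      ≤ (1 - (1 - q ^ #S) * (1 - q ^ (Fintype.card α - #S))) ^ Fintype.card β := by
  let col : Finset (α × β) → β → Finset α := fun A j => {i | (i, j) ∈ A}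
  have hinj : Function.Injective col := fun A A' h => by
    ext ⟨i, j⟩
    simpa [col] using Finset.ext_iff.mp (congrFun h j) i
  have hcard : ∀ A, #A = ∑ j, #(col A j) := fun A => by
    rw [card_eq_sum_card_fiberwise (f := Prod.snd) (t := univ) (by simp)]
    refine sum_congr rfl fun j _ => ?_
    refine card_bij' (fun x _ => x.1) (fun i _ => (i, j)) ?_ ?_ ?_ ?_
    · rintro ⟨i, j'⟩ h; simp only [mem_filter] at h; obtain ⟨h, rfl⟩ := h; simpa [col] using h
    · intro i h; simpa [col] using h
    · rintro ⟨i, j'⟩ h; simp only [mem_filter] at h; simp [h.2]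
    · simp
  let w : Finset α → ℝ := fun B => p ^ #B * q ^ (Fintype.card α - #B)
  have hw : ∀ A : Finset (α × β), p ^ #A * q ^ (Fintype.card α * Fintype.card β - #A)
      = ∏ j, w (col A j) := fun A => by
    have h1 : Fintype.card α * Fintype.card β - #A = ∑ j, (Fintype.card α - #(col A j)) := by
      rw [sum_tsub_distrib _ fun j _ => card_le_univ _, ← hcard]; simp [mul_comm]
    rw [prod_mul_distrib, prod_pow_eq_pow_sum, prod_pow_eq_pow_sum, ← h1, ← hcard]
  simp only [hw]
  rw [← sum_powerset_union_powerset_compl S hpq, ← card_univ (α := β), ← prod_const,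
    prod_univ_sum, ← sum_image (f := fun F : β → Finset α => ∏ j, w (F j)) hinj.injOn]
  refine sum_le_sum_of_subset_of_nonneg ?_ fun F _ _ => ?_
  · intro F hF
    obtain ⟨A, hA, rfl⟩ := mem_image.mp hF
    have hA := (mem_filter.mp hA).2
    refine Fintype.mem_piFinset.mpr fun j => ?_
    simp only [mem_union, mem_powerset]
    by_contra! h
    obtain ⟨h1, h2⟩ := h
    obtain ⟨i, hi, hiS⟩ := not_subset.mp h1
    obtain ⟨i', hi', hiS'⟩ := not_subset.mp h2
    have := hA i i' j (by simpa [col] using hi) (by simpa [col] using hi')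
    simp only [mem_compl, not_not] at hiS'
    exact hiS (this.mpr hiS')
  · exact prod_nonneg fun j _ => mul_nonneg (pow_nonneg hp _) (pow_nonneg hq _)

theorem mul_div_one_add_mul_le_one_sub_pow {p : ℝ} (hp0 : 0 ≤ p) (hp1 : p ≤ 1) (s : ℕ) :
    s * p / (1 + s * p) ≤ 1 - (1 - p) ^ s := by
  have h1 : 1 + s * p ≤ (1 + p) ^ s := one_add_mul_le_pow (by linarith) s
  have h2 : (1 - p) ^ s * (1 + p) ^ s ≤ 1 := by
    rw [← mul_pow]; exact pow_le_one₀ (by nlinarith) (by nlinarith)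
  have h3 : (1 - p) ^ s * (1 + s * p) ≤ 1 :=
    (mul_le_mul_of_nonneg_left h1 (pow_nonneg (by linarith) s)).trans h2
  have h4 : (0 : ℝ) ≤ s * p := by positivity
  rw [div_le_iff₀ (by linarith)]
  linarith

/-- The exponent in the probability that a set of size `s ≤ a / 2` separates is at least linear in
`s`. The factor `8` absorbs `a - s ≥ a / 2` and `(1 + a * p) ^ 2 ≤ 4 * max 1 (a * p) ^ 2`. -/
theorem mul_min_le_mul_one_sub_pow {a b s : ℕ} {p : ℝ} (ha : 0 < a) (hp0 : 0 ≤ p) (hp1 : p ≤ 1)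
    (hs : 2 * s ≤ a) :
    s * (min (a * b * p ^ 2) (b / a) / 8)
      ≤ b * ((1 - (1 - p) ^ s) * (1 - (1 - p) ^ (a - s))) := by
  have ha' : (0 : ℝ) < a := by exact_mod_cast ha
  have hs1 : (s : ℝ) ≤ a := by exact_mod_cast (by omega : s ≤ a)
  have ht1 : ((a - s : ℕ) : ℝ) ≤ a := by exact_mod_cast Nat.sub_le a s
  have ht2 : (a : ℝ) ≤ 2 * (a - s : ℕ) := by exact_mod_cast (by omega : a ≤ 2 * (a - s))
  set t := a - s
  have hx := mul_div_one_add_mul_le_one_sub_pow hp0 hp1 s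
  have hy := mul_div_one_add_mul_le_one_sub_pow hp0 hp1 t
  have hx' : s * p / (1 + a * p) ≤ 1 - (1 - p) ^ s := le_trans (by gcongr) hx
  have hy' : a * p / 2 / (1 + a * p) ≤ 1 - (1 - p) ^ t :=
    le_trans (by gcongr; nlinarith) hy
  have hmain : (s : ℝ) * (min (a * b * p ^ 2) (b / a) / 8)
      ≤ b * ((s * p / (1 + a * p)) * (a * p / 2 / (1 + a * p))) := by
    have e : (b : ℝ) * ((s * p / (1 + a * p)) * (a * p / 2 / (1 + a * p)))
        = s * ((a * b * p ^ 2) / (2 * (1 + a * p) ^ 2)) := by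
      have : (1 + a * p) ≠ 0 := by positivity
      field_simp
    rw [e]
    refine mul_le_mul_of_nonneg_left ?_ (Nat.cast_nonneg s)
    -- If `a * p ≤ 1` the denominator is bounded; otherwise it cancels `p ^ 2` and leaves `b / a`.
    rcases le_total (a * p) 1 with h | h
    · calc min (a * b * p ^ 2) (b / a) / 8 ≤ (a * b * p ^ 2) / 8 := by gcongr; exact min_le_left _ _
        _ ≤ _ := by
          gcongr
          have : 0 ≤ a * p := by positivity
          nlinarith
    · calc min (a * b * p ^ 2) (b / a) / 8 ≤ (b / a : ℝ) / 8 := by gcongr; exact min_le_right _ _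
        _ = (a * b * p ^ 2) / (8 * (a * p) ^ 2) := by
          have : p ≠ 0 := by rintro rfl; simp at h; linarith
          field_simp
        _ ≤ _ := by
          refine div_le_div_of_nonneg_left (by positivity) (by positivity) ?_
          nlinarith
  refine hmain.trans (mul_le_mul_of_nonneg_left ?_ (Nat.cast_nonneg b))
  exact mul_le_mul hx' hy' (by positivity) ((by positivity : (0 : ℝ) ≤ _).trans hx')

open Finset Classical in
/-- The `e`-edge sets separated by `S` all have the same weight in the independent model, so their
number is bounded by the probability of separation there. -/
theorem card_isSeparatedBy_mul_le {α β : Type*} [Fintype α] [Fintype β] [Nonempty α] {e : ℕ}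
    {S : Finset α} (hS : 2 * #S ≤ Fintype.card α) {p : ℝ} (hp0 : 0 ≤ p) (hp1 : p ≤ 1) :
    #{A : Finset (α × β) | #A = e ∧ IsSeparatedBy S A}
        * (p ^ e * (1 - p) ^ (Fintype.card α * Fintype.card β - e))
      ≤ Real.exp (-(min (Fintype.card α * Fintype.card β * p ^ 2)
          (Fintype.card β / Fintype.card α) / 8)) ^ #S := by
  have hq : 0 ≤ 1 - p := by linarith
  calc _ = ∑ A : Finset (α × β) with #A = e ∧ IsSeparatedBy S A,
        p ^ #A * (1 - p) ^ (Fintype.card α * Fintype.card β - #A) := by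
        rw [← nsmul_eq_mul, ← sum_const]
        refine sum_congr rfl fun A hA => ?_
        rw [(mem_filter.mp hA).2.1]
    _ ≤ ∑ A : Finset (α × β) with IsSeparatedBy S A,
        p ^ #A * (1 - p) ^ (Fintype.card α * Fintype.card β - #A) := by
        refine sum_le_sum_of_subset_of_nonneg ?_ fun A _ _ => by positivity
        intro A hA
        simp only [mem_filter] at hA ⊢
        exact ⟨hA.1, hA.2.2⟩
    _ ≤ (1 - (1 - (1 - p) ^ #S) * (1 - (1 - p) ^ (Fintype.card α - #S))) ^ Fintype.card β :=
        sum_isSeparatedBy_le S hp0 hq (by ring)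
    _ ≤ Real.exp (-((1 - (1 - p) ^ #S) * (1 - (1 - p) ^ (Fintype.card α - #S))))
          ^ Fintype.card β := by
        have h1 : (1 - p) ^ #S ≤ 1 := pow_le_one₀ hq (by linarith)
        have h2 : (1 - p) ^ (Fintype.card α - #S) ≤ 1 := pow_le_one₀ hq (by linarith)
        have h3 : 0 ≤ (1 - p) ^ #S := by positivity
        have h4 : 0 ≤ (1 - p) ^ (Fintype.card α - #S) := by positivity
        gcongr
        · nlinarith
        · exact Real.one_sub_le_exp_neg _
    _ ≤ _ := by
        rw [← Real.exp_nat_mul, ← Real.exp_nat_mul, Real.exp_le_exp]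
        have := mul_min_le_mul_one_sub_pow (b := Fintype.card β) Fintype.card_pos hp0 hp1 hS
        linarith

open Finset Classical in
/-- Union bound over the separating sets `S` with at most half of the elements of `α`, at
`p = e / (#α * #β)`. -/
theorem card_exists_isSeparatedBy_le {α β : Type*} [Fintype α] [Fintype β] [Nonempty α]
    [Nonempty β] {e : ℕ} (he : e ≤ Fintype.card α * Fintype.card β) :
    (#{A : Finset (α × β) | #A = e ∧
        ∃ S : Finset α, S.Nonempty ∧ 2 * #S ≤ Fintype.card α ∧ IsSeparatedBy S A} : ℝ)
      ≤ (Fintype.card α * Fintype.card β + 1) *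
        (Real.exp (Fintype.card α * Real.exp
          (-(min ((e : ℝ) ^ 2 / (Fintype.card α * Fintype.card β))
            (Fintype.card β / Fintype.card α) / 8))) - 1) *
        (Fintype.card α * Fintype.card β).choose e := by
  set a := Fintype.card α with ha
  set b := Fintype.card β with hb
  have ha0 : 0 < a := Fintype.card_pos
  have hb0 : 0 < b := Fintype.card_pos
  have hN : 0 < a * b := by positivity
  set p : ℝ := e / (a * b : ℕ) with hp
  have hp0 : 0 ≤ p := by positivity
  have hp1 : p ≤ 1 := by
    rw [hp, div_le_one (by exact_mod_cast hN)]; exact_mod_cast he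
  have hL : (e : ℝ) ^ 2 / (a * b) = a * b * p ^ 2 := by
    rw [hp]; push_cast; field_simp
  rw [hL]
  set x : ℝ := Real.exp (-(min (a * b * p ^ 2) (b / a) / 8)) with hx
  set c : ℝ := p ^ e * (1 - p) ^ (a * b - e) with hc
  have hc0 : 0 ≤ c := mul_nonneg (pow_nonneg hp0 _) (pow_nonneg (by linarith) _)
  have hmode : (1 : ℝ) ≤ ((a * b : ℕ) + 1) * ((a * b).choose e * c) :=
    one_le_succ_mul_choose_mul_pow hN he
  set bad : Finset (Finset (α × β)) := {A | #A = e ∧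
        ∃ S : Finset α, S.Nonempty ∧ 2 * #S ≤ a ∧ IsSeparatedBy S A} with hbad
  have hbadc : #bad * c ≤ Real.exp (a * x) - 1 := by
    calc (#bad : ℝ) * c
        ≤ (∑ S : Finset α with S.Nonempty ∧ 2 * #S ≤ a,
            (#{A : Finset (α × β) | #A = e ∧ IsSeparatedBy S A} : ℝ)) * c := by
          refine mul_le_mul_of_nonneg_right ?_ hc0
          rw [← Nat.cast_sum]
          refine Nat.cast_le.mpr ((card_le_card ?_).trans card_biUnion_le)
          intro A hA
          obtain ⟨h1, S, h2, h3, h4⟩ := (mem_filter.mp hA).2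
          exact mem_biUnion.mpr ⟨S, by simp [h2, h3], by simp [h1, h4]⟩
      _ ≤ ∑ S : Finset α with S.Nonempty ∧ 2 * #S ≤ a, x ^ #S := by
          rw [sum_mul]
          refine sum_le_sum fun S hS => ?_
          exact card_isSeparatedBy_mul_le (mem_filter.mp hS).2.2 hp0 hp1
      _ ≤ ∑ S ∈ (univ : Finset (Finset α)).erase ∅, x ^ #S := by
          refine sum_le_sum_of_subset_of_nonneg ?_ fun S _ _ => by positivity
          intro S hS
          simpa using (mem_filter.mp hS).2.1.ne_empty
      _ = (x + 1) ^ a - 1 := by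
          -- Expand `(x + 1) ^ a` over all subsets; the empty one contributes `1`.
          rw [sum_erase_eq_sub (mem_univ _), ha, ← Fintype.sum_pow_mul_eq_add_pow α x 1]
          simp
      _ ≤ Real.exp x ^ a - 1 := by
          gcongr
          exact Real.add_one_le_exp x
      _ = _ := by rw [← Real.exp_nat_mul]
  calc (#bad : ℝ) ≤ #bad * (((a * b : ℕ) + 1) * ((a * b).choose e * c)) :=
        le_mul_of_one_le_right (Nat.cast_nonneg _) hmode
    _ = ((a * b : ℕ) + 1) * (a * b).choose e * (#bad * c) := by ring
    _ ≤ ((a * b : ℕ) + 1) * (a * b).choose e * (Real.exp (a * x) - 1) := by gcongr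
    _ = _ := by push_cast; ring

/-! ### Bipartite graphs as sets of pairs -/

open Classical in
/-- The edges of `G` between the two parts, as pairs. This determines `G` when `G` is bipartite
with these parts. -/
noncomputable def edgePairs {α β : Type*} [Fintype α] [Fintype β] (G : SimpleGraph (α ⊕ β)) :
    Finset (α × β) :=
  {x | G.Adj (Sum.inl x.1) (Sum.inr x.2)}

theorem mem_edgePairs {α β : Type*} [Fintype α] [Fintype β] {G : SimpleGraph (α ⊕ β)}
    {i : α} {j : β} : (i, j) ∈ edgePairs G ↔ G.Adj (Sum.inl i) (Sum.inr j) := by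
  simp [edgePairs]

theorem injective_sym2_inl_inr {α β : Type*} :
    Function.Injective fun x : α × β => s((Sum.inl x.1 : α ⊕ β), Sum.inr x.2) := by
  rintro ⟨i, j⟩ ⟨i', j'⟩ h
  simpa using h

theorem edgeSet_eq_image_edgePairs {α β : Type*} [Fintype α] [Fintype β] {G : SimpleGraph (α ⊕ β)}
    (hG : G.IsBipartiteWith (Set.range Sum.inl) (Set.range Sum.inr)) :
    G.edgeSet = (fun x : α × β => s((Sum.inl x.1 : α ⊕ β), Sum.inr x.2)) '' edgePairs G := by
  ext e
  induction e with | _ u v =>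
  simp only [SimpleGraph.mem_edgeSet, Set.mem_image, Finset.mem_coe, Prod.exists, mem_edgePairs]
  constructor
  · intro h
    rcases hG.mem_of_adj h with ⟨⟨i, rfl⟩, ⟨j, rfl⟩⟩ | ⟨⟨j, rfl⟩, ⟨i, rfl⟩⟩
    · exact ⟨i, j, h, rfl⟩
    · exact ⟨i, j, h.symm, Sym2.eq_swap⟩
  · rintro ⟨i, j, h, h'⟩
    rw [← SimpleGraph.mem_edgeSet, ← h']
    exact h

theorem bijOn_edgePairs (a b e : ℕ) :
    Set.BijOn edgePairs (bipartiteGraphs a b e) {A : Finset (Fin a × Fin b) | A.card = e} := by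
  refine ⟨fun G hG => ?_, fun G hG G' hG' h => ?_, fun A hA => ?_⟩
  · have := hG.2
    rw [edgeSet_eq_image_edgePairs hG.1, Set.ncard_image_of_injective _ injective_sym2_inl_inr,
      Set.ncard_coe_finset] at this
    exact this
  · rw [← SimpleGraph.edgeSet_inj, edgeSet_eq_image_edgePairs hG.1,
      edgeSet_eq_image_edgePairs hG'.1, h]
  · set G : SimpleGraph (Fin a ⊕ Fin b) := SimpleGraph.fromEdgeSet
      ((fun x : Fin a × Fin b => s((Sum.inl x.1 : Fin a ⊕ Fin b), Sum.inr x.2)) '' A) with hG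
    have hb : G.IsBipartiteWith (Set.range Sum.inl) (Set.range Sum.inr) := by
      refine ⟨Set.isCompl_range_inl_range_inr.disjoint, fun u v h => ?_⟩
      obtain ⟨⟨i, j⟩, -, h⟩ := ((SimpleGraph.fromEdgeSet_adj _).mp h).1
      rcases Sym2.eq_iff.mp h with ⟨rfl, rfl⟩ | ⟨rfl, rfl⟩ <;> simp
    have hA' : edgePairs G = A := by
      ext ⟨i, j⟩
      rw [mem_edgePairs, hG, SimpleGraph.fromEdgeSet_adj]
      simp
    refine ⟨G, ⟨hb, ?_⟩, hA'⟩
    rw [edgeSet_eq_image_edgePairs hb, Set.ncard_image_of_injective _ injective_sym2_inl_inr,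
      Set.ncard_coe_finset, hA']
    exact hA

theorem ncard_bipartiteGraphs (a b e : ℕ) :
    (bipartiteGraphs a b e).ncard = (a * b).choose e := by
  have h : {A : Finset (Fin a × Fin b) | A.card = e}
      = ((Finset.univ : Finset (Fin a × Fin b)).powersetCard e : Set _) := by
    ext A; simp
  rw [← (bijOn_edgePairs a b e).injOn.ncard_image, (bijOn_edgePairs a b e).image_eq, h,
    Set.ncard_coe_finset, Finset.card_powersetCard]
  simp

open Finset in
/-- If the first part meets two components, then the trace of one of them or its complement is a
separating set with at most half of the vertices. -/
theorem exists_isSeparatedBy_edgePairs {a b : ℕ} {G : SimpleGraph (Fin a ⊕ Fin b)}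
    (hG : G ∉ firstPartConnected a b) :
    ∃ S : Finset (Fin a), S.Nonempty ∧ 2 * #S ≤ Fintype.card (Fin a) ∧
      IsSeparatedBy S (edgePairs G) := by
  classical
  simp only [firstPartConnected, Set.mem_ofPred_eq, not_forall] at hG
  obtain ⟨u, v, huv⟩ := hG
  let S : Finset (Fin a) :=
    {x | G.connectedComponentMk (Sum.inl x) = G.connectedComponentMk (Sum.inl u)}
  have hS : ∀ i i' j, (i, j) ∈ edgePairs G → (i', j) ∈ edgePairs G → (i ∈ S ↔ i' ∈ S) := by
    intro i i' j h h'
    have h1 := SimpleGraph.ConnectedComponent.connectedComponentMk_eq_of_adj (mem_edgePairs.mp h)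
    have h2 := SimpleGraph.ConnectedComponent.connectedComponentMk_eq_of_adj (mem_edgePairs.mp h')
    simp only [S, Finset.mem_filter, Finset.mem_univ, true_and, h1, h2]
  by_cases h : 2 * #S ≤ Fintype.card (Fin a)
  · exact ⟨S, ⟨u, by simp [S]⟩, h, hS⟩
  · refine ⟨Sᶜ, ⟨v, by
      simp only [S, mem_compl, mem_filter, mem_univ, true_and]
      exact fun h => huv h.symm⟩, ?_, fun i i' j hi hi' => ?_⟩
    · rw [card_compl]; omega
    · simpa [not_iff_not] using hS i i' j hi hi'

/-- For parts of arbitrary positive sizes `a` and `b`, the first part meets several components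
with probability at most `(a * b + 1) * (exp (a * exp (-L)) - 1)`, where
`L = min (e ^ 2 / (a * b)) (b / a) / 8`. -/
theorem one_sub_le_randomBipartiteGraph {a b e : ℕ} (ha : 0 < a) (hb : 0 < b) (he : e ≤ a * b) :
    1 - ENNReal.ofReal ((a * b + 1) * (Real.exp (a * Real.exp
        (-(min ((e : ℝ) ^ 2 / (a * b)) (b / a) / 8))) - 1)) ≤
      randomBipartiteGraph a b e (firstPartConnected a b) := by
  classical
  let _ : MeasurableSpace (SimpleGraph (Fin a ⊕ Fin b)) := ⊤
  have : Nonempty (Fin a) := ⟨⟨0, ha⟩⟩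
  have : Nonempty (Fin b) := ⟨⟨0, hb⟩⟩
  have hfin : (bipartiteGraphs a b e).Finite := Set.toFinite _
  have hpos : 0 < (a * b).choose e := Nat.choose_pos he
  have hne : (bipartiteGraphs a b e).Nonempty := by
    rw [← Set.ncard_pos hfin, ncard_bipartiteGraphs]; exact hpos
  set B : ℝ := (a * b + 1) * (Real.exp (a * Real.exp
        (-(min ((e : ℝ) ^ 2 / (a * b)) (b / a) / 8))) - 1)
  have hbad : ((bipartiteGraphs a b e ∩ (firstPartConnected a b)ᶜ).ncard : ℝ)
      ≤ B * (a * b).choose e := by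
    have h := card_exists_isSeparatedBy_le (α := Fin a) (β := Fin b) (e := e) (by simpa using he)
    simp only [Fintype.card_fin] at h
    refine le_trans ?_ h
    rw [← Set.ncard_coe_finset, Nat.cast_le]
    refine Set.ncard_le_ncard_of_injOn edgePairs ?_
      ((bijOn_edgePairs a b e).injOn.mono Set.inter_subset_left) (Set.toFinite _)
    intro G hG
    have h1 : (edgePairs G).card = e := (bijOn_edgePairs a b e).mapsTo hG.1
    have h2 := exists_isSeparatedBy_edgePairs hG.2
    rw [Fintype.card_fin] at h2
    simpa using ⟨h1, h2⟩
  have hcount : ∀ s : Set (SimpleGraph (Fin a ⊕ Fin b)),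
      MeasureTheory.Measure.count s = (s.ncard : ENNReal) := fun s => by
    rw [MeasureTheory.Measure.count_apply MeasurableSpace.measurableSet_top,
      ← Set.Finite.cast_ncard_eq (Set.toFinite s), ENat.toENNReal_coe]
  have hcompl : randomBipartiteGraph a b e (firstPartConnected a b)ᶜ ≤ ENNReal.ofReal B := by
    rw [randomBipartiteGraph, ProbabilityTheory.uniformOn,
      ProbabilityTheory.cond_apply MeasurableSpace.measurableSet_top, hcount, hcount,
      ncard_bipartiteGraphs, mul_comm, ← div_eq_mul_inv]
    refine ENNReal.div_le_of_le_mul ?_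
    rw [← ENNReal.ofReal_natCast ((a * b).choose e), ← ENNReal.ofReal_mul' (Nat.cast_nonneg _),
      ← ENNReal.ofReal_natCast]
    exact ENNReal.ofReal_le_ofReal hbad
  have hsum : randomBipartiteGraph a b e (firstPartConnected a b)
      + randomBipartiteGraph a b e (firstPartConnected a b)ᶜ = 1 :=
    ProbabilityTheory.uniformOn_compl _ hfin hne
  rw [tsub_le_iff_right, ← hsum]
  gcongr

/-! ### Asymptotics -/

open Filter Topology in
theorem tendsto_natCast_pow_mul_exp_neg_rpow {δ c : ℝ} (hδ : 0 < δ) (hc : 0 < c) (k : ℕ) :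
    Tendsto (fun n : ℕ => (n : ℝ) ^ k * Real.exp (-c * (n : ℝ) ^ δ)) atTop (𝓝 0) := by
  have h := (tendsto_rpow_mul_exp_neg_mul_atTop_nhds_zero (k / δ) c hc).comp
    ((tendsto_rpow_atTop hδ).comp tendsto_natCast_atTop_atTop)
  refine h.congr fun n => ?_
  simp only [Function.comp_apply]
  rw [← Real.rpow_mul (Nat.cast_nonneg n), mul_div_cancel₀ _ hδ.ne', Real.rpow_natCast]

open Filter Topology in
/-- The error term of the union bound vanishes when the exponent `L` grows at least like a power
of `n`. -/
theorem tendsto_mul_exp_mul_exp_sub_one {L : ℕ → ℝ} {δ c : ℝ} (hδ : 0 < δ) (hc : 0 < c)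
    (m k : ℕ) (hL : ∀ᶠ n : ℕ in atTop, c * (n : ℝ) ^ δ ≤ L n) :
    Tendsto (fun n : ℕ => ((n : ℝ) ^ k + 1) * (Real.exp ((n : ℝ) ^ m * Real.exp (-L n)) - 1))
      atTop (𝓝 0) := by
  have h1 := (tendsto_natCast_pow_mul_exp_neg_rpow hδ hc m).eventually_le_const one_pos
  have h2 := (tendsto_natCast_pow_mul_exp_neg_rpow hδ hc (k + m)).const_mul 4
  rw [mul_zero] at h2
  refine squeeze_zero' (Eventually.of_forall fun n => ?_) ?_ h2
  · have : 0 ≤ (n : ℝ) ^ m * Real.exp (-L n) := by positivity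
    have := Real.one_le_exp this
    exact mul_nonneg (by positivity) (by linarith)
  · filter_upwards [h1, hL, eventually_ge_atTop 1] with n h1 h2 hn
    have hn : (1 : ℝ) ≤ (n : ℝ) ^ k := one_le_pow₀ (by exact_mod_cast hn)
    set y := (n : ℝ) ^ m * Real.exp (-c * (n : ℝ) ^ δ) with hy
    have hy0 : 0 ≤ y := by positivity
    have hle : (n : ℝ) ^ m * Real.exp (-L n) ≤ y := by
      rw [hy]; gcongr; linarith
    have h3 : Real.exp y - 1 ≤ 2 * y := by
      have := Real.abs_exp_sub_one_le (x := y) (by rwa [abs_of_nonneg hy0])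
      rw [abs_of_nonneg hy0] at this
      exact (le_abs_self _).trans this
    calc _ ≤ ((n : ℝ) ^ k + n ^ k) * (2 * y) := by
          gcongr
          · have := Real.one_le_exp (x := (n : ℝ) ^ m * Real.exp (-L n)) (by positivity)
            linarith
          · have := Real.exp_le_exp.mpr hle
            linarith
      _ = _ := by rw [hy, pow_add]; ring

theorem mainTheorem9 (m : ℕ) (d : ℝ) (hd : d ∈ Set.Ioo (1 / 2 : ℝ) 1) (E : ℕ → ℕ)
    (hE : ∀ n : ℕ, |(E n : ℝ) - (n : ℝ) ^ ((2 * (m : ℝ) + 1) * d)| < 1) :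
    Filter.Tendsto
      (fun n : ℕ => randomBipartiteGraph (n ^ m) (n ^ (m + 1)) (E n)
        (firstPartConnected (n ^ m) (n ^ (m + 1))))
      Filter.atTop (nhds 1) := by
  obtain ⟨hd1, hd2⟩ := hd
  have hk : (0 : ℝ) < 2 * m + 1 := by positivity
  set r : ℝ := (2 * m + 1) * d with hr
  have hr0 : 0 < r := mul_pos hk (by linarith)
  set δ : ℝ := min ((2 * m + 1) * (2 * d - 1)) 1 with hδ
  have hδ0 : 0 < δ := lt_min (mul_pos hk (by linarith)) one_pos
  have hrpow : ∀ s : ℝ, 0 < s →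
      Filter.Tendsto (fun n : ℕ => (n : ℝ) ^ s) Filter.atTop Filter.atTop := fun s hs =>
    (tendsto_rpow_atTop hs).comp tendsto_natCast_atTop_atTop
  -- Eventually there is room for `E n` edges, so that the uniform law is a probability measure.
  have hle : ∀ᶠ n : ℕ in Filter.atTop, E n ≤ n ^ m * n ^ (m + 1) := by
    filter_upwards [(hrpow _ (show 0 < (2 * m + 1) * (1 - d) from
      mul_pos hk (by linarith))).eventually_ge_atTop 2, Filter.eventually_ge_atTop 1] with n h2 hn
    have hn' : (1 : ℝ) ≤ n := by exact_mod_cast hn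
    have h1 : (1 : ℝ) ≤ (n : ℝ) ^ r := Real.one_le_rpow hn' hr0.le
    have h3 : (n : ℝ) ^ r * (n : ℝ) ^ ((2 * m + 1) * (1 - d)) = (n : ℝ) ^ (2 * m + 1) := by
      rw [← Real.rpow_add (by linarith), ← Real.rpow_natCast]
      congr 1; push_cast; rw [hr]; ring
    have h4 := (abs_lt.mp (hE n)).2
    have h5 : (E n : ℝ) ≤ (n : ℝ) ^ (2 * m + 1) := by nlinarith
    have h6 : n ^ m * n ^ (m + 1) = n ^ (2 * m + 1) := by ring
    rw [h6]; exact_mod_cast h5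
  -- Since `E n ≥ n ^ r / 2`, the ratio `E n ^ 2 / n ^ (2 * m + 1)` grows like a positive power of
  -- `n`, precisely because `d > 1 / 2`.
  have hL : ∀ᶠ n : ℕ in Filter.atTop, 1 / 32 * (n : ℝ) ^ δ ≤
      min ((E n : ℝ) ^ 2 / (((n ^ m : ℕ) : ℝ) * ((n ^ (m + 1) : ℕ) : ℝ)))
        (((n ^ (m + 1) : ℕ) : ℝ) / ((n ^ m : ℕ) : ℝ)) / 8 := by
    filter_upwards [(hrpow r hr0).eventually_ge_atTop 2, Filter.eventually_ge_atTop 1] with n h2 hn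
    have hn' : (1 : ℝ) ≤ n := by exact_mod_cast hn
    have hn0 : (0 : ℝ) < n := by linarith
    have h1 : (n : ℝ) ^ r / 2 ≤ E n := by linarith [(abs_lt.mp (hE n)).1]
    have h3 : (n : ℝ) ^ r * (n : ℝ) ^ r
        = (n : ℝ) ^ ((2 * m + 1) * (2 * d - 1)) * (n ^ m * n ^ (m + 1)) := by
      rw [← pow_add, ← Real.rpow_natCast, ← Real.rpow_add hn0, ← Real.rpow_add hn0]
      congr 1; push_cast; rw [hr]; ring
    have h4 : (n : ℝ) ^ δ ≤ (n : ℝ) ^ ((2 * m + 1) * (2 * d - 1)) :=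
      Real.rpow_le_rpow_of_exponent_le hn' (min_le_left _ _)
    have h5 : (n : ℝ) ^ δ ≤ n := by
      simpa using Real.rpow_le_rpow_of_exponent_le hn' (min_le_right ((2 * m + 1) * (2 * d - 1)) 1)
    have h6 : (n : ℝ) ^ δ / 4 ≤ min ((E n : ℝ) ^ 2 / (((n ^ m : ℕ) : ℝ) * ((n ^ (m + 1) : ℕ) : ℝ)))
        (((n ^ (m + 1) : ℕ) : ℝ) / ((n ^ m : ℕ) : ℝ)) := by
      push_cast
      refine le_min ?_ ?_
      · rw [le_div_iff₀ (by positivity)]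
        have h7 : ((n : ℝ) ^ r / 2) ^ 2 ≤ (E n : ℝ) ^ 2 := by gcongr
        have h8 : (n : ℝ) ^ δ * (n ^ m * n ^ (m + 1)) ≤
          (n : ℝ) ^ ((2 * m + 1) * (2 * d - 1)) * (n ^ m * n ^ (m + 1)) := by gcongr
        nlinarith
      · rw [pow_succ, mul_div_cancel_left₀ _ (by positivity)]
        linarith
    linarith
  have hB := tendsto_mul_exp_mul_exp_sub_one hδ0 (by norm_num) m (2 * m + 1) hL
  have hB' := ENNReal.Tendsto.sub (tendsto_const_nhds (x := (1 : ENNReal)))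
    (ENNReal.tendsto_ofReal hB) (Or.inl ENNReal.one_ne_top)
  rw [ENNReal.ofReal_zero, tsub_zero] at hB'
  refine tendsto_of_tendsto_of_tendsto_of_le_of_le' hB' tendsto_const_nhds ?_
    (Filter.Eventually.of_forall fun n => ?_)
  · filter_upwards [hle, Filter.eventually_ge_atTop 1] with n h hn
    have h1 := one_sub_le_randomBipartiteGraph (pow_pos hn m) (pow_pos hn (m + 1)) h
    have h2 : (n : ℝ) ^ (2 * m + 1) = ((n ^ m : ℕ) : ℝ) * ((n ^ (m + 1) : ℕ) : ℝ) := by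
      push_cast; ring
    rw [h2, ← Nat.cast_pow n m]
    exact h1
  · let _ : MeasurableSpace (SimpleGraph (Fin (n ^ m) ⊕ Fin (n ^ (m + 1)))) := ⊤
    have : MeasureTheory.IsZeroOrProbabilityMeasure
        (randomBipartiteGraph (n ^ m) (n ^ (m + 1)) (E n)) :=
      inferInstanceAs (MeasureTheory.IsZeroOrProbabilityMeasure (ProbabilityTheory.uniformOn _))
    exact MeasureTheory.prob_le_one
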